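/- Let $\mathcal H_A=\mathbb C^{a}$ and $\mathcal H_B=\mathbb C^{b}$ be finite-dimensional Hilbert spaces with $b\ge 1$, and let $\rho$ be a state (positive semidefinite operator of trace one) on $\mathcal H_A\otimes\mathcal H_B$. An $n$-POVM is an ordered family $E=(E_i)_{i=1}^n$ of positive semidefinite operators on $\mathcal H_A$ with $\sum_i E_i=\mathbb I_A$; it is an $n$-PVM if every $E_i$ is an orthogonal projection. Let $\mathcal S_B$ be the set of pure states of $\mathcal H_B$ (rank-one orthogonal projections), and let $\omega$ be the uniform distribution on $\mathcal S_B$, i.e. the image of the Haar probability measure of the unitary group of $\mathcal H_B$ under $W\mapsto WP_0W^\dagger$ for a pure state $P_0$. For a set $\mathcal M$ of POVMs on $\mathcal H_A$, a Borel probability measure $u$ on $\mathcal S_B$ is an LHS ensemble for $\rho$ with respect to $\mathcal M$ if for every $E=(E_i)_{i=1}^{m}\in\mathcal M$ there are measurable functions $G_i:\mathcal S_B\to[0,\infty)$, $1\le i\le m$, with $\sum_iG_i(P)=1$ for all $P$ and $$\operatorname{Tr}_A[\rho(E_i\otimes\mathbb I_B)]=\int_{\mathcal S_B}G_i(P)\,P\,du(P)\qquad(1\le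 i\le m);$$ $\rho$ is unsteerable with $\mathcal M$ if such a $u$ exists. Let $G$ be a compact topological group with continuous unitary representations $U$ on $\mathcal H_A$ and $V$ on $\mathcal H_B$, and suppose that $\rho$ is $(G,U,V)$-symmetric: $\rho=(U(g)^\dagger\otimes V(g)^\dagger)\,\rho\,(U(g)\otimes V(g))$ for all $g\in G$. Let $R_V(g)u$ be the image of the measure $u$ under $P\mapsto V(g)PV(g)^\dagger$; for a density $u$ with respect to $\omega$ this is $[R_V(g)u](P)=u(V(g)^\dagger PV(g))$. Let $n\in\mathbb N$, and let $\mathcal M$ be the set of all $n$-POVMs, or the set of all $n$-PVMs, or the set of all PVMs with any number of outcomes. Then: 1. If $\rho$ is unsteerable with $\mathcal M$, then it has an LHS ensemble $u^*$ with respect to $\mathcal M$ such that $u^*=R_V(g)u^*$ for all $g\in G$. 2. If $\rho$ has an LHS ensemble with respect to $\mathcal M$ with a (finite, measurable) density with respect to $\omega$, then it has one whose density $u^*$ satisfies $u^*(P)=u^*(V(g)^\dagger PV(g))$ for all $g\in G$ and all $P\in\mathcal S_B$. 3. Suppose that $G$ acts transitively on $\mathcal S_B$ by $P\mapsto V(g)PV(g)^\dagger$.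 If $\rho$ is unsteerable with $\mathcal M$, then $\omega$ is an LHS ensemble for $\rho$ with respect to $\mathcal M$. Moreover, $\omega$ is the only probability measure on $\mathcal S_B$ that is invariant under all $R_V(g)$. -/

import Mathlib

open MeasureTheory
open scoped Matrix Kronecker NNReal ENNReal ComplexOrder

noncomputable section

namespace Steering

/-! ### States and measurements

The finite-dimensional Hilbert spaces of Alice and Bob are `ℂ^a` and `ℂ^b`, for finite index types
`a` and `b`; operators are matrices, and operators on the tensor product are matrices indexed
by `a × b`. -/

/-- `ρ` is a bipartite quantum state (density operator) on `ℂ^a ⊗ ℂ^b`. -/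
structure IsState {a b : Type*} [Fintype a] [Fintype b]
    (ρ : Matrix (a × b) (a × b) ℂ) : Prop where
  posSemidef : ρ.PosSemidef
  trace_eq_one : ρ.trace = 1

/-- A POVM on `ℂ^a` with finitely many ordered outcomes. -/
structure POVM (a : Type*) [Fintype a] [DecidableEq a] where
  /-- the number of outcomes -/
  outcomes : ℕ
  /-- the effects `E_i` -/
  effect : Fin outcomes → Matrix a a ℂ
  effect_posSemidef : ∀ i, (effect i).PosSemidef
  sum_effect : ∑ i, effect i = 1

/-- A POVM is projection valued (a PVM) if all its effects are orthogonal projections. The effects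
are Hermitian already; idempotents which sum to the identity are mutually orthogonal. -/
def POVM.IsProjective {a : Type*} [Fintype a] [DecidableEq a] (E : POVM a) : Prop :=
  ∀ i, E.effect i * E.effect i = E.effect i

/-- The set of POVMs with `n` outcomes. -/
def nPOVMs (a : Type*) [Fintype a] [DecidableEq a] (n : ℕ) : Set (POVM a) :=
  {E | E.outcomes = n}

/-- The set of PVMs with `n` outcomes. -/
def nPVMs (a : Type*) [Fintype a] [DecidableEq a] (n : ℕ) : Set (POVM a) :=
  {E | E.outcomes = n ∧ E.IsProjective}

/-- The set of all PVMs, with any number of outcomes. -/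
def PVMs (a : Type*) [Fintype a] [DecidableEq a] : Set (POVM a) :=
  {E | E.IsProjective}

/-- The partial trace `Tr_A` over the first tensor factor. -/
def partialTraceA {a b : Type*} [Fintype a] (M : Matrix (a × b) (a × b) ℂ) : Matrix b b ℂ :=
  Matrix.of fun j k => ∑ i, M (i, j) (i, k)

/-- The steering map `X ↦ Tr_A[ρ (X ⊗ 1)]`. -/
def steer {a b : Type*} [Fintype a] [Fintype b] [DecidableEq b]
    (ρ : Matrix (a × b) (a × b) ℂ) (X : Matrix a a ℂ) : Matrix b b ℂ :=
  partialTraceA (ρ * (X ⊗ₖ (1 : Matrix b b ℂ)))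

/-! ### Pure states and ensembles -/

/-- The pure states on `ℂ^b`: the rank-one orthogonal projections, with the topology inherited from
the space of matrices and its Borel σ-algebra. -/
def PureState (b : Type*) [Fintype b] : Type _ :=
  {P : Matrix b b ℂ // P.IsHermitian ∧ P * P = P ∧ P.trace = 1}

instance (b : Type*) [Fintype b] : TopologicalSpace (PureState b) :=
  inferInstanceAs (TopologicalSpace {P : Matrix b b ℂ // P.IsHermitian ∧ P * P = P ∧ P.trace = 1})

instance (b : Type*) [Fintype b] : MeasurableSpace (PureState b) := borel _

instance (b : Type*) [Fintype b] : BorelSpace (PureState b) := ⟨rfl⟩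

/-- The action `P ↦ W P W†` of a unitary `W` on pure states. -/
def PureState.conj {b : Type*} [Fintype b] [DecidableEq b]
    (W : Matrix.unitaryGroup b ℂ) (P : PureState b) : PureState b :=
  ⟨(W : Matrix b b ℂ) * P.1 * (W : Matrix b b ℂ)ᴴ, by
    obtain ⟨P, hH, hP, hT⟩ := P
    have hW : (W : Matrix b b ℂ)ᴴ * (W : Matrix b b ℂ) = 1 := Matrix.UnitaryGroup.star_mul_self W
    refine ⟨Matrix.isHermitian_mul_mul_conjTranspose _ hH, ?_, ?_⟩
    · calc (W : Matrix b b ℂ) * P * (W : Matrix b b ℂ)ᴴ * (W * P * (W : Matrix b b ℂ)ᴴ)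
          = W * P * ((W : Matrix b b ℂ)ᴴ * W) * P * (W : Matrix b b ℂ)ᴴ := by
            simp only [Matrix.mul_assoc]
        _ = W * (P * P) * (W : Matrix b b ℂ)ᴴ := by
            rw [hW, Matrix.mul_one]; simp only [Matrix.mul_assoc]
        _ = W * P * (W : Matrix b b ℂ)ᴴ := by rw [hP]
    · rw [Matrix.trace_mul_comm, ← Matrix.mul_assoc, hW, Matrix.one_mul]
      exact hT⟩

/-- The pure state `|i⟩⟨i|` of a basis vector. -/
def PureState.basis {b : Type*} [Fintype b] [DecidableEq b] (i : b) : PureState b :=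
  ⟨Matrix.single i i 1, by
    refine ⟨?_, ?_, ?_⟩
    · simp [Matrix.IsHermitian]
    · simp
    · simp⟩

instance (b : Type*) [Fintype b] [DecidableEq b] : MeasurableSpace (Matrix.unitaryGroup b ℂ) :=
  borel _

instance (b : Type*) [Fintype b] [DecidableEq b] : BorelSpace (Matrix.unitaryGroup b ℂ) := ⟨rfl⟩

instance (b : Type*) [Fintype b] [DecidableEq b] : CompactSpace (Matrix.unitaryGroup b ℂ) := by
  refine isCompact_iff_compactSpace.mp (IsCompact.of_isClosed_subset
    (isCompact_univ_pi fun _ : b => isCompact_univ_pi fun _ : b =>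
      isCompact_closedBall (0 : ℂ) 1) (isClosed_unitary (R := Matrix b b ℂ)) ?_)
  intro W hW i _ j _
  simpa using entry_norm_bound_of_unitary hW i j

/-- The normalized Haar measure `ω` (uniform distribution) on the pure states of `ℂ^b`: the image
of the Haar probability measure of the unitary group `U(b)` under the orbit map `W ↦ W P₀ W†`.
As `U(b)` acts transitively on pure states, the choice of `P₀` is immaterial. -/
def uniform (b : Type*) [Fintype b] [DecidableEq b] [Nonempty b] : Measure (PureState b) :=
  (Measure.haarMeasure (⊤ : TopologicalSpace.PositiveCompacts (Matrix.unitaryGroup b ℂ))).map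
    fun W => PureState.conj W (PureState.basis (Classical.arbitrary b))

/-! ### Local hidden state models -/

/-- `G` is a family of (measurable) response functions on pure states, one for each outcome. -/
structure IsResponse {b : Type*} [Fintype b] {n : ℕ} (G : Fin n → PureState b → ℝ) : Prop where
  measurable : ∀ i, Measurable (G i)
  nonneg : ∀ i P, 0 ≤ G i P
  sum_eq_one : ∀ P, ∑ i, G i P = 1

/-- The operator `∫ G(P) P du(P)`, the integral being taken entrywise. -/
def simulated {b : Type*} [Fintype b] (u : Measure (PureState b)) (G : PureState b → ℝ) :
    Matrix b b ℂ :=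
  Matrix.of fun j k => ∫ P, (G P : ℂ) * P.1 j k ∂u

/-- The ensemble (probability measure) `u` on Bob's pure states is an LHS ensemble for `ρ` with
respect to the set `𝓜` of measurements of Alice, i.e. `ρ` is `u`-unsteerable with `𝓜`. -/
structure IsLHSEnsemble {a b : Type*} [Fintype a] [Fintype b] [DecidableEq a] [DecidableEq b]
    (ρ : Matrix (a × b) (a × b) ℂ) (𝓜 : Set (POVM a)) (u : Measure (PureState b)) : Prop where
  isProbabilityMeasure : IsProbabilityMeasure u
  simulates : ∀ E ∈ 𝓜, ∃ G : Fin E.outcomes → PureState b → ℝ, IsResponse G ∧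
    ∀ i, steer ρ (E.effect i) = simulated u (G i)

/-- `ρ` is unsteerable (from Alice's side) with the measurements in `𝓜`. -/
def Unsteerable {a b : Type*} [Fintype a] [Fintype b] [DecidableEq a] [DecidableEq b]
    (ρ : Matrix (a × b) (a × b) ℂ) (𝓜 : Set (POVM a)) : Prop :=
  ∃ u : Measure (PureState b), IsLHSEnsemble ρ 𝓜 u

/-- The ensemble with density `u` with respect to the Haar measure on pure states. -/
def ofDensity {b : Type*} [Fintype b] [DecidableEq b] [Nonempty b] (u : PureState b → ℝ≥0) :
    Measure (PureState b) :=
  (uniform b).withDensity fun P => (u P : ℝ≥0∞)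

/-! ### Symmetry -/

/-- `ρ` is `(G, U, V)`-symmetric: `ρ = (U(g)† ⊗ V(g)†) ρ (U(g) ⊗ V(g))` for all `g`. -/
def IsSymmetric {a b G : Type*} [Fintype a] [Fintype b] [DecidableEq a] [DecidableEq b] [Group G]
    (ρ : Matrix (a × b) (a × b) ℂ)
    (U : G →* Matrix.unitaryGroup a ℂ) (V : G →* Matrix.unitaryGroup b ℂ) : Prop :=
  ∀ g, ρ = ((U g : Matrix a a ℂ)ᴴ ⊗ₖ (V g : Matrix b b ℂ)ᴴ) * ρ *
    ((U g : Matrix a a ℂ) ⊗ₖ (V g : Matrix b b ℂ))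

/-- The induced action `R_V(g)` on ensembles: the image measure under `P ↦ V(g) P V(g)†`. -/
def actEnsemble {b G : Type*} [Fintype b] [DecidableEq b] [Group G]
    (V : G →* Matrix.unitaryGroup b ℂ) (g : G) (u : Measure (PureState b)) :
    Measure (PureState b) :=
  u.map (PureState.conj (V g))

/-- The induced action on densities, `[R_V(g) u](P) = u(V(g)† P V(g))`. -/
def actDensity {b G : Type*} [Fintype b] [DecidableEq b] [Group G]
    (V : G →* Matrix.unitaryGroup b ℂ) (g : G) (u : PureState b → ℝ≥0) : PureState b → ℝ≥0 :=
  fun P => u (PureState.conj (V g)⁻¹ P)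

/-- `G` acts transitively on Bob's pure states through `V`. -/
def ActsTransitively {b G : Type*} [Fintype b] [DecidableEq b] [Group G]
    (V : G →* Matrix.unitaryGroup b ℂ) : Prop :=
  ∀ P Q : PureState b, ∃ g, PureState.conj (V g) P = Q

end Steering

end

/-! Symmetry of `ρ` makes steering equivariant: rotating Alice's effect by `U g` rotates Bob's
operator by `V g` (`IsSymmetric.steer_conj`). As `𝓜` is stable under unitary rotations, each
translate `R_V(g) u` of an LHS ensemble `u` is again one. Averaging the translates over Haar measure
gives an invariant measure, and it remains to show that a mixture of LHS ensembles is an LHS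
ensemble.

The difficulty is that response functions are chosen separately for each `g`, with no measurability
in `g`, so they cannot simply be integrated. For a fixed measurement, the Haar integral is therefore
extended to a positive functional `Λ` on all bounded functions of `g`. The functionals `f ↦ Λ (g ↦ ∫
r_{g,i} f d(R_V(g) u))` are positive on continuous functions, hence are measures `ν_i` by
Riesz–Markov. Their sum is the mixture, so their Radon–Nikodym derivatives are response functions
(`exists_response_bind`). The simulated operators come out right because each of their entries is
constant in `g`, and `Λ` is the true integral on constants.

With a density, Tonelli and the unitary invariance of `uniform b` show that the average has the
averaged density. In the transitive case, Fubini identifies every invariant probability measure with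
the same image of Haar measure (`apply_eq_haarMeasure_of_invariant`). -/

namespace MeasureTheory

/-! ### Mixtures with non-measurable response functions -/

/-- The space of bounded real functions on a type. -/
def boundedFunctions (Ω : Type*) : Submodule ℝ (Ω → ℝ) where
  carrier := {h | ∃ C, ∀ x, |h x| ≤ C}
  add_mem' := by
    rintro f g ⟨C, hC⟩ ⟨D, hD⟩
    exact ⟨C + D, fun x => (abs_add_le _ _).trans (add_le_add (hC x) (hD x))⟩
  zero_mem' := ⟨0, fun x => by simp⟩
  smul_mem' := by
    rintro c f ⟨C, hC⟩
    exact ⟨|c| * C, fun x => by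
      simpa [abs_mul] using mul_le_mul_of_nonneg_left (hC x) (abs_nonneg c)⟩

theorem integrable_of_mem_boundedFunctions {Ω : Type*} [MeasurableSpace Ω] {μ : Measure Ω}
    [IsFiniteMeasure μ] {h : Ω → ℝ} (hb : h ∈ boundedFunctions Ω) (hm : Measurable h) :
    Integrable h μ := by
  obtain ⟨C, hC⟩ := hb
  exact Integrable.of_bound hm.aestronglyMeasurable C (Filter.Eventually.of_forall hC)

/-- The integral against a probability measure extends to a positive functional on all bounded
functions, measurable or not. -/
theorem exists_positive_extension_integral {Ω : Type*} [MeasurableSpace Ω] (μ : Measure Ω)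
    [IsProbabilityMeasure μ] :
    ∃ Λ : boundedFunctions Ω →ₗ[ℝ] ℝ, (∀ h, (∀ x, 0 ≤ h.1 x) → 0 ≤ Λ h) ∧
      ∀ h, Measurable h.1 → Λ h = ∫ x, h.1 x ∂μ := by
  let D : Submodule ℝ (boundedFunctions Ω) :=
    { carrier := {h | Measurable h.1}
      add_mem' := fun hf hg => Measurable.add hf hg
      zero_mem' := measurable_const
      smul_mem' := fun c _ hf => Measurable.const_smul hf c }
  let I : D →ₗ[ℝ] ℝ :=
    { toFun := fun h => ∫ x, h.1.1 x ∂μ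
      map_add' := fun f g => integral_add
        (integrable_of_mem_boundedFunctions f.1.2 f.2)
        (integrable_of_mem_boundedFunctions g.1.2 g.2)
      map_smul' := fun c f => integral_const_mul c _ }
  let C : PointedCone ℝ (boundedFunctions Ω) :=
    { carrier := {h | ∀ x, 0 ≤ h.1 x}
      add_mem' := fun hf hg x => add_nonneg (hf x) (hg x)
      zero_mem' := fun x => le_rfl
      smul_mem' := fun c _ hf x => mul_nonneg c.2 (hf x) }
  obtain ⟨Λ, hΛ, hpos⟩ := riesz_extension C ⟨D, I⟩
    (fun h hh => integral_nonneg hh)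
    (by
      intro y
      obtain ⟨c, hc⟩ := y.2
      -- The extension theorem needs every bounded function to become nonnegative after adding a
      -- measurable one; a constant bound suffices.
      refine ⟨⟨⟨fun _ => c, |c|, fun _ => le_rfl⟩, measurable_const⟩, fun x => ?_⟩
      have := neg_le_of_abs_le (hc x)
      change 0 ≤ c + y.1 x
      linarith)
  exact ⟨Λ, hpos, fun h hh => hΛ ⟨h, hh⟩⟩

/-- Positive functionals on the continuous functions of a compact space are integrals. -/
theorem exists_finiteMeasure_of_positive {X : Type*} [TopologicalSpace X] [T2Space X]
    [CompactSpace X] [MeasurableSpace X] [BorelSpace X] (Φ : C(X, ℝ) →ₗ[ℝ] ℝ)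
    (hΦ : ∀ f : C(X, ℝ), (∀ x, 0 ≤ f x) → 0 ≤ Φ f) :
    ∃ ν : Measure X, IsFiniteMeasure ν ∧ ∀ f : C(X, ℝ), ∫ x, f x ∂ν = Φ f := by
  let T : CompactlySupportedContinuousMap X ℝ →ₗ[ℝ] C(X, ℝ) :=
    { toFun := fun f => f.toContinuousMap
      map_add' := fun _ _ => rfl
      map_smul' := fun _ _ => rfl }
  let L := PositiveLinearMap.mk₀ (Φ ∘ₗ T) fun f hf => hΦ _ fun x =>
    CompactlySupportedContinuousMap.le_def.1 hf x
  refine ⟨RealRMK.rieszMeasure L, inferInstance, fun f => ?_⟩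
  exact RealRMK.integral_rieszMeasure L (CompactlySupportedContinuousMap.continuousMapEquiv f)

/-- The bound is uniform in `u` and `r`, so a family of such integrals is a bounded function of its
parameter, to which an extended functional applies. -/
theorem abs_integral_mul_le_norm {X : Type*} [TopologicalSpace X] [CompactSpace X]
    [MeasurableSpace X] [BorelSpace X] (u : Measure X) [IsProbabilityMeasure u] {r : X → ℝ}
    (h0 : ∀ x, 0 ≤ r x) (h1 : ∀ x, r x ≤ 1) (f : C(X, ℝ)) :
    |∫ x, r x * f x ∂u| ≤ ‖f‖ := by
  have : ∀ᵐ x ∂u, ‖r x * f x‖ ≤ ‖f‖ := Filter.Eventually.of_forall fun x => by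
    rw [norm_mul, Real.norm_of_nonneg (h0 x)]
    calc r x * ‖f x‖ ≤ 1 * ‖f x‖ := mul_le_mul_of_nonneg_right (h1 x) (norm_nonneg _)
      _ ≤ ‖f‖ := by rw [one_mul]; exact f.norm_coe_le_norm x
  simpa using norm_integral_le_of_norm_le_const this

theorem integrable_mul_continuousMap {X : Type*} [TopologicalSpace X] [CompactSpace X]
    [MeasurableSpace X] [BorelSpace X] (u : Measure X) [IsFiniteMeasure u] {r : X → ℝ}
    (hr : Measurable r) (h0 : ∀ x, 0 ≤ r x) (h1 : ∀ x, r x ≤ 1) (f : C(X, ℝ)) :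
    Integrable (fun x => r x * f x) u := by
  refine Integrable.of_bound (hr.mul f.continuous.measurable).aestronglyMeasurable ‖f‖
    (Filter.Eventually.of_forall fun x => ?_)
  rw [norm_mul, Real.norm_of_nonneg (h0 x)]
  calc r x * ‖f x‖ ≤ 1 * ‖f x‖ := mul_le_mul_of_nonneg_right (h1 x) (norm_nonneg _)
    _ ≤ ‖f‖ := by rw [one_mul]; exact f.norm_coe_le_norm x

/-- Finite measures which sum to `u` have densities which sum to one everywhere; `r` is only used
to choose the densities on a null set. -/
theorem exists_densities_of_sum_eq {X : Type*} [MeasurableSpace X] {ι : Type*} [Fintype ι]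
    (u : Measure X) [IsFiniteMeasure u] (ν : ι → Measure X) [∀ i, IsFiniteMeasure (ν i)]
    (hν : ∑ i, ν i = u) (r : ι → X → ℝ) (hr : ∀ i, Measurable (r i)) (hr0 : ∀ i x, 0 ≤ r i x)
    (hr1 : ∀ x, ∑ i, r i x = 1) :
    ∃ g : ι → X → ℝ, (∀ i, Measurable (g i)) ∧ (∀ i x, 0 ≤ g i x) ∧ (∀ x, ∑ i, g i x = 1) ∧
      ∀ i (f : X → ℝ), ∫ x, g i x * f x ∂u = ∫ x, f x ∂(ν i) := by
  classical
  have hle : ∀ i, ν i ≤ u := fun i => by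
    rw [← hν]
    exact Finset.single_le_sum (f := ν) (fun _ _ => Measure.zero_le _) (Finset.mem_univ i)
  have hac : ∀ i, ν i ≪ u := fun i => (hle i).absolutelyContinuous
  let d : ι → X → ℝ := fun i x => ((ν i).rnDeriv u x).toReal
  have hd : ∀ i, Measurable (d i) := fun i => (Measure.measurable_rnDeriv _ _).ennreal_toReal
  let S : Set X := {x | ∑ i, d i x = 1}
  have hS : MeasurableSet S :=
    measurableSet_eq_fun (Finset.measurable_fun_sum _ fun i _ => hd i) measurable_const
  have hae : ∀ᵐ x ∂u, x ∈ S := by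
    -- Over any measurable set both sides integrate to its `u`-measure.
    have h1 : (fun x => ∑ i, (ν i).rnDeriv u x) =ᵐ[u] fun _ => 1 := by
      refine ae_eq_of_forall_setLIntegral_eq_of_sigmaFinite
        (Finset.measurable_fun_sum _ fun i _ => Measure.measurable_rnDeriv _ _)
        measurable_const fun s hs _ => ?_
      rw [lintegral_finsetSum _ fun i _ => Measure.measurable_rnDeriv _ _]
      simp_rw [Measure.setLIntegral_rnDeriv (hac _)]
      rw [setLIntegral_one]
      conv_rhs => rw [← hν]
      simp
    have h2 : ∀ᵐ x ∂u, ∀ i, (ν i).rnDeriv u x < ∞ :=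
      ae_all_iff.2 fun i => Measure.rnDeriv_lt_top _ _
    filter_upwards [h1, h2] with x hx hx'
    change ∑ i, d i x = 1
    rw [← ENNReal.toReal_sum fun i _ => (hx' i).ne, hx, ENNReal.toReal_one]
  refine ⟨fun i => S.piecewise (d i) (r i), fun i => (hd i).piecewise hS (hr i), fun i x => ?_,
    fun x => ?_, fun i f => ?_⟩
  · by_cases hx : x ∈ S
    · simp [hx, d]
    · simp [hx, hr0]
  · by_cases hx : x ∈ S
    · simp_rw [Set.piecewise_eq_of_mem _ _ _ hx]
      exact hx
    · simp [hx, hr1]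
  · rw [← integral_rnDeriv_smul (hac i)]
    refine integral_congr_ae ?_
    filter_upwards [hae] with x hx
    simp [hx, d]

open ProbabilityTheory in
/-- Response functions for a family of ensembles can be merged into response functions for the
mixture of the family, although they need not depend measurably on the parameter. -/
theorem exists_response_bind {X Ω : Type*} [TopologicalSpace X] [T2Space X] [CompactSpace X]
    [HasOuterApproxClosed X] [MeasurableSpace X] [BorelSpace X] [MeasurableSpace Ω]
    (μ : Measure Ω) [IsProbabilityMeasure μ] (κ : Kernel Ω X) [IsMarkovKernel κ]
    {ι : Type*} [Fintype ι] (r : Ω → ι → X → ℝ) (hr : ∀ ω i, Measurable (r ω i))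
    (hr0 : ∀ ω i x, 0 ≤ r ω i x) (hr1 : ∀ ω x, ∑ i, r ω i x = 1) :
    ∃ g : ι → X → ℝ, (∀ i, Measurable (g i)) ∧ (∀ i x, 0 ≤ g i x) ∧ (∀ x, ∑ i, g i x = 1) ∧
      ∀ i (f : C(X, ℝ)) (c : ℝ), (∀ ω, ∫ x, r ω i x * f x ∂(κ ω) = c) →
        ∫ x, g i x * f x ∂(μ.bind κ) = c := by
  have hle : ∀ ω i x, r ω i x ≤ 1 := fun ω i x => by
    rw [← hr1 ω x]
    exact Finset.single_le_sum (f := fun i => r ω i x) (fun j _ => hr0 ω j x) (Finset.mem_univ i)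
  obtain ⟨Λ, hpos, hΛ⟩ := exists_positive_extension_integral μ
  have hint : ∀ ω i (f : C(X, ℝ)), Integrable (fun x => r ω i x * f x) (κ ω) := fun ω i f =>
    integrable_mul_continuousMap _ (hr ω i) (hr0 ω i) (hle ω i) f
  -- The values of `B i` may be non-measurable in `ω`; only the extended functional `Λ` can be
  -- applied to them.
  let B : ι → C(X, ℝ) →ₗ[ℝ] boundedFunctions Ω := fun i =>
    { toFun := fun f => ⟨fun ω => ∫ x, r ω i x * f x ∂(κ ω), ‖f‖, fun ω =>
        abs_integral_mul_le_norm _ (hr0 ω i) (hle ω i) f⟩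
      map_add' := fun f g => Subtype.ext <| funext fun ω => by
        simpa [mul_add] using integral_add (hint ω i f) (hint ω i g)
      map_smul' := fun c f => Subtype.ext <| funext fun ω => by
        simpa [mul_left_comm] using integral_const_mul c fun x => r ω i x * f x }
  have hν := fun i => exists_finiteMeasure_of_positive (Λ ∘ₗ B i) fun f hf =>
    hpos _ fun ω => integral_nonneg fun x => mul_nonneg (hr0 ω i x) (hf x)
  choose ν hfin hν using hν
  have hsum : ∑ i, ν i = μ.bind κ := by
    refine ext_of_forall_integral_eq_of_IsFiniteMeasure fun f => ?_
    have hif : ∀ (ρ : Measure X) [IsFiniteMeasure ρ], Integrable f ρ := fun ρ _ => f.integrable ρ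
    have hbind : ∫ x, f x ∂(μ.bind κ) = ∫ ω, ∫ x, f x ∂(κ ω) ∂μ := by
      have := Kernel.integral_comp (η := κ) (κ := Kernel.const Unit μ) (a := ()) (f := f)
        (by rw [Kernel.comp_apply, Kernel.const_apply]; exact hif _)
      rwa [Kernel.comp_apply, Kernel.const_apply] at this
    rw [integral_finsetSum_measure fun i _ => hif _, hbind]
    have hm : Measurable fun ω => ∫ x, f x ∂(κ ω) :=
      (f.continuous.stronglyMeasurable.integral_kernel).measurable
    let F : boundedFunctions Ω := ⟨fun ω => ∫ x, f x ∂(κ ω), ‖f‖, fun ω =>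
      f.norm_integral_le_norm _⟩
    -- Summing over outcomes removes `r`; what remains is measurable in `ω`, so there `Λ` is the
    -- true integral.
    have hF : ∑ i, B i f.toContinuousMap = F := Subtype.ext <| funext fun ω => by
      simp only [Submodule.coe_sum, Finset.sum_apply]
      change ∑ i, ∫ x, r ω i x * f x ∂(κ ω) = ∫ x, f x ∂(κ ω)
      refine (integral_finsetSum _ fun i _ => hint ω i f.toContinuousMap).symm.trans ?_
      simp_rw [← Finset.sum_mul, hr1, one_mul]
      rfl
    calc ∑ i, ∫ x, f x ∂(ν i) = ∑ i, Λ (B i f.toContinuousMap) :=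
          Finset.sum_congr rfl fun i _ => hν i f.toContinuousMap
      _ = Λ F := by rw [← map_sum, hF]
      _ = _ := hΛ F hm
  obtain ⟨ω₀⟩ : Nonempty Ω := nonempty_of_isProbabilityMeasure μ
  obtain ⟨g, hg, hg0, hg1, hgν⟩ :=
    exists_densities_of_sum_eq _ ν hsum (r ω₀) (hr ω₀) (hr0 ω₀) (hr1 ω₀)
  refine ⟨g, hg, hg0, hg1, fun i f c hc => ?_⟩
  rw [hgν, hν]
  -- A constant function is measurable, so `Λ` returns `c` whatever extension was chosen.
  have hB : B i f = ⟨fun _ => c, |c|, fun _ => le_rfl⟩ := Subtype.ext <| funext hc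
  rw [LinearMap.comp_apply, hB, hΛ _ measurable_const]
  simp

end MeasureTheory

/-! ### Topology of pure states and the unitary action -/

namespace Steering

section Topology

variable {b : Type*} [Fintype b]

theorem PureState.continuous_val : Continuous fun P : PureState b => P.1 := continuous_subtype_val

theorem PureState.continuous_entry (j k : b) : Continuous fun P : PureState b => P.1 j k :=
  PureState.continuous_val.matrix_elem j k

theorem secondCountableTopology_matrix : SecondCountableTopology (Matrix b b ℂ) :=
  inferInstanceAs (SecondCountableTopology (b → b → ℂ))

instance PureState.instSecondCountableTopology : SecondCountableTopology (PureState b) :=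
  haveI := secondCountableTopology_matrix (b := b)
  TopologicalSpace.Subtype.secondCountableTopology _

instance PureState.instMetrizableSpace : TopologicalSpace.MetrizableSpace (PureState b) :=
  haveI : TopologicalSpace.MetrizableSpace (Matrix b b ℂ) :=
    inferInstanceAs (TopologicalSpace.MetrizableSpace (b → b → ℂ))
  Topology.IsEmbedding.subtypeVal.metrizableSpace

/-- Comparing diagonal entries in `P = P P†` gives `P j j = ∑ l, ‖P j l‖ ^ 2`. Hence `‖P j j‖ ^ 2 ≤
‖P j j‖`, so the diagonal is at most one, and it dominates the squares of its row. -/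
theorem norm_entry_le_one {P : Matrix b b ℂ} (hH : P.IsHermitian) (hP : P * P = P)
    (j k : b) : ‖P j k‖ ≤ 1 := by
  have key : ∀ j, P j j = ((∑ l, ‖P j l‖ ^ 2 : ℝ) : ℂ) := fun j => by
    conv_lhs => rw [← hP]
    rw [Matrix.mul_apply]
    push_cast
    refine Finset.sum_congr rfl fun l _ => ?_
    rw [← hH.apply l j, ← Complex.ofReal_pow, ← Complex.normSq_eq_norm_sq, ← Complex.mul_conj]
    rfl
  have hn : ‖P j j‖ = ∑ l, ‖P j l‖ ^ 2 := by
    conv_lhs => rw [key j]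
    rw [Complex.norm_real, Real.norm_of_nonneg (Finset.sum_nonneg fun _ _ => sq_nonneg _)]
  have hle : ∀ l, ‖P j l‖ ^ 2 ≤ ‖P j j‖ := fun l => by
    rw [hn]
    exact Finset.single_le_sum (f := fun l => ‖P j l‖ ^ 2) (fun _ _ => sq_nonneg _)
      (Finset.mem_univ l)
  have hj := hle j
  have hk := hle k
  have h1 : ‖P j j‖ ≤ 1 := by nlinarith [norm_nonneg (P j j)]
  nlinarith [norm_nonneg (P j k)]

instance PureState.instCompactSpace : CompactSpace (PureState b) := by
  have hc : IsClosed {P : Matrix b b ℂ | P.IsHermitian ∧ P * P = P ∧ P.trace = 1} := by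
    refine IsClosed.inter ?_ (IsClosed.inter ?_ ?_)
    · exact isClosed_eq continuous_id.matrix_conjTranspose continuous_id
    · exact isClosed_eq (continuous_id.matrix_mul continuous_id) continuous_id
    · exact isClosed_eq continuous_id.matrix_trace continuous_const
  refine isCompact_iff_compactSpace.mp (IsCompact.of_isClosed_subset
    (isCompact_univ_pi fun _ : b => isCompact_univ_pi fun _ : b =>
      isCompact_closedBall (0 : ℂ) 1) hc ?_)
  intro P hP i _ j _
  simpa using norm_entry_le_one hP.1 hP.2.1 i j

variable [DecidableEq b]

instance instSecondCountableTopologyUnitaryGroup :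
    SecondCountableTopology (Matrix.unitaryGroup b ℂ) :=
  haveI := secondCountableTopology_matrix (b := b)
  TopologicalSpace.Subtype.secondCountableTopology _

theorem PureState.continuous_conj_uncurry :
    Continuous fun x : Matrix.unitaryGroup b ℂ × PureState b => PureState.conj x.1 x.2 := by
  have h1 : Continuous fun x : Matrix.unitaryGroup b ℂ × PureState b => (x.1 : Matrix b b ℂ) :=
    continuous_subtype_val.comp continuous_fst
  exact Continuous.subtype_mk
    ((h1.matrix_mul (PureState.continuous_val.comp continuous_snd)).matrix_mul
      h1.matrix_conjTranspose) _

/-- Second countability of both factors identifies the product σ-algebra with the Borel one, so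
joint continuity is enough. -/
theorem PureState.measurable_conj_uncurry :
    Measurable (Function.uncurry (PureState.conj (b := b))) :=
  PureState.continuous_conj_uncurry.measurable

theorem PureState.measurable_conj (W : Matrix.unitaryGroup b ℂ) :
    Measurable (PureState.conj W) :=
  PureState.measurable_conj_uncurry.of_uncurry_left

theorem PureState.measurable_conj_left (P : PureState b) :
    Measurable fun W : Matrix.unitaryGroup b ℂ => PureState.conj W P :=
  PureState.measurable_conj_uncurry.of_uncurry_right

theorem PureState.conj_conj (W W' : Matrix.unitaryGroup b ℂ) (P : PureState b) :
    PureState.conj W (PureState.conj W' P) = PureState.conj (W * W') P := by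
  apply Subtype.ext
  simp [PureState.conj, Matrix.conjTranspose_mul, Matrix.mul_assoc]

theorem PureState.conj_one (P : PureState b) : PureState.conj 1 P = P := by
  apply Subtype.ext
  simp [PureState.conj]

theorem PureState.conj_inv_conj (W : Matrix.unitaryGroup b ℂ) (P : PureState b) :
    PureState.conj W⁻¹ (PureState.conj W P) = P := by
  rw [PureState.conj_conj, inv_mul_cancel, PureState.conj_one]

end Topology

/-! ### Invariance of the uniform distribution -/

section Uniform

theorem isProbabilityMeasure_haarMeasure_top {G : Type*} [Group G] [TopologicalSpace G]
    [IsTopologicalGroup G] [CompactSpace G] [MeasurableSpace G] [BorelSpace G] :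
    IsProbabilityMeasure (Measure.haarMeasure (⊤ : TopologicalSpace.PositiveCompacts G)) :=
  ⟨by simpa using Measure.haarMeasure_self (K₀ := (⊤ : TopologicalSpace.PositiveCompacts G))⟩

variable {b : Type*} [Fintype b] [DecidableEq b] [Nonempty b]

instance instIsProbabilityMeasureUniform : IsProbabilityMeasure (uniform b) :=
  haveI := isProbabilityMeasure_haarMeasure_top (G := Matrix.unitaryGroup b ℂ)
  Measure.isProbabilityMeasure_map (PureState.measurable_conj_left _).aemeasurable

/-- The orbit map intertwines left multiplication by `W` with conjugation by `W`, and Haar measure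
is left invariant. -/
theorem measurePreserving_conj_uniform (W : Matrix.unitaryGroup b ℂ) :
    MeasurePreserving (PureState.conj W) (uniform b) (uniform b) := by
  refine ⟨PureState.measurable_conj W, ?_⟩
  rw [uniform, Measure.map_map (PureState.measurable_conj W) (PureState.measurable_conj_left _)]
  have : (PureState.conj W ∘ fun W' => PureState.conj W' (PureState.basis (Classical.arbitrary b)))
      = (fun W' => PureState.conj W' (PureState.basis (Classical.arbitrary b))) ∘ (W * ·) := by
    funext W'
    exact PureState.conj_conj _ _ _
  rw [this, ← Measure.map_map (PureState.measurable_conj_left _) (measurable_const_mul W),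
    map_mul_left_eq_self]

end Uniform

end Steering

/-! ### Equivariance of steering and rotated measurements -/

namespace Steering

section Symmetry

variable {a b G : Type*} [Fintype a] [Fintype b]

/-- Cyclicity survives under the partial trace for operators acting on the traced factor alone. -/
theorem partialTraceA_kronecker_mul_comm [DecidableEq b] (A : Matrix a a ℂ)
    (M : Matrix (a × b) (a × b) ℂ) :
    partialTraceA ((A ⊗ₖ (1 : Matrix b b ℂ)) * M) =
      partialTraceA (M * (A ⊗ₖ (1 : Matrix b b ℂ))) := by
  ext j k
  simp only [partialTraceA, Matrix.of_apply, Matrix.mul_apply, Fintype.sum_prod_type,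
    Matrix.kroneckerMap_apply, Matrix.one_apply]
  simp only [mul_ite, mul_one, mul_zero, ite_mul, zero_mul, Finset.sum_ite_eq,
    Finset.sum_ite_eq', Finset.mem_univ, if_true]
  rw [Finset.sum_comm]
  exact Finset.sum_congr rfl fun _ _ => Finset.sum_congr rfl fun _ _ => mul_comm _ _

theorem partialTraceA_one_kronecker_mul [DecidableEq a] (B : Matrix b b ℂ)
    (M : Matrix (a × b) (a × b) ℂ) :
    partialTraceA (((1 : Matrix a a ℂ) ⊗ₖ B) * M) = B * partialTraceA M := by
  ext j k
  simp only [partialTraceA, Matrix.of_apply, Matrix.mul_apply, Fintype.sum_prod_type,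
    Matrix.kroneckerMap_apply, Matrix.one_apply]
  simp only [ite_mul, one_mul, zero_mul]
  rw [Finset.sum_congr rfl fun i _ => Finset.sum_comm, Finset.sum_comm]
  simp [Finset.mul_sum]

theorem partialTraceA_mul_one_kronecker [DecidableEq a] (B : Matrix b b ℂ)
    (M : Matrix (a × b) (a × b) ℂ) :
    partialTraceA (M * ((1 : Matrix a a ℂ) ⊗ₖ B)) = partialTraceA M * B := by
  ext j k
  simp only [partialTraceA, Matrix.of_apply, Matrix.mul_apply, Fintype.sum_prod_type,
    Matrix.kroneckerMap_apply, Matrix.one_apply]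
  simp only [ite_mul, one_mul, zero_mul, mul_ite, mul_zero]
  rw [Finset.sum_congr rfl fun i _ => Finset.sum_comm, Finset.sum_comm]
  simp [Finset.sum_mul]

variable [DecidableEq a] [DecidableEq b]

theorem IsSymmetric.steer_conj [Group G] {ρ : Matrix (a × b) (a × b) ℂ}
    {U : G →* Matrix.unitaryGroup a ℂ} {V : G →* Matrix.unitaryGroup b ℂ}
    (hsymm : IsSymmetric ρ U V) (g : G) (X : Matrix a a ℂ) :
    steer ρ ((U g : Matrix a a ℂ) * X * (U g : Matrix a a ℂ)ᴴ) =
      (V g : Matrix b b ℂ) * steer ρ X * (V g : Matrix b b ℂ)ᴴ := by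
  have hU : (U g : Matrix a a ℂ) * (U g : Matrix a a ℂ)ᴴ = 1 := Unitary.coe_mul_star_self (U g)
  have hU' : (U g : Matrix a a ℂ)ᴴ * (U g : Matrix a a ℂ) = 1 := Unitary.coe_star_mul_self (U g)
  have hV : (V g : Matrix b b ℂ) * (V g : Matrix b b ℂ)ᴴ = 1 := Unitary.coe_mul_star_self (V g)
  have hg := hsymm g
  generalize (U g : Matrix a a ℂ) = A at *
  generalize (V g : Matrix b b ℂ) = B at *
  have hcomm : ρ * (A ⊗ₖ B) = (A ⊗ₖ B) * ρ := by
    conv_rhs => rw [hg]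
    rw [← Matrix.mul_assoc, ← Matrix.mul_assoc, ← Matrix.mul_kronecker_mul, hU, hV,
      Matrix.one_kronecker_one, Matrix.one_mul]
  -- The factors acting on Bob move outside, where the partial trace lets them through; those on
  -- Alice then cancel by cyclicity.
  have hfactor : ρ * ((A * X * Aᴴ) ⊗ₖ (1 : Matrix b b ℂ)) =
      (1 ⊗ₖ B) * (((A ⊗ₖ 1) * (ρ * (X ⊗ₖ 1) * (Aᴴ ⊗ₖ 1))) * (1 ⊗ₖ Bᴴ)) :=
    calc ρ * ((A * X * Aᴴ) ⊗ₖ (1 : Matrix b b ℂ))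
        = ρ * ((A ⊗ₖ B) * (X ⊗ₖ 1) * (Aᴴ ⊗ₖ Bᴴ)) := by
          rw [← Matrix.mul_kronecker_mul, ← Matrix.mul_kronecker_mul, Matrix.mul_one, hV]
      _ = (A ⊗ₖ B) * (ρ * (X ⊗ₖ 1) * (Aᴴ ⊗ₖ Bᴴ)) := by
          simp only [← Matrix.mul_assoc, hcomm]
      _ = ((1 ⊗ₖ B) * (A ⊗ₖ 1)) * (ρ * (X ⊗ₖ 1) * ((Aᴴ ⊗ₖ 1) * (1 ⊗ₖ Bᴴ))) := by
          simp only [← Matrix.mul_kronecker_mul, Matrix.mul_one, Matrix.one_mul]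
      _ = _ := by simp only [Matrix.mul_assoc]
  rw [steer, steer, hfactor, partialTraceA_one_kronecker_mul, partialTraceA_mul_one_kronecker,
    partialTraceA_kronecker_mul_comm, Matrix.mul_assoc (ρ * _), ← Matrix.mul_kronecker_mul, hU',
    Matrix.mul_one, Matrix.one_kronecker_one, Matrix.mul_one, ← Matrix.mul_assoc]

/-- The rotated measurement with effects `W E_i W†`. -/
def POVM.conj (W : Matrix.unitaryGroup a ℂ) (E : POVM a) : POVM a where
  outcomes := E.outcomes
  effect i := (W : Matrix a a ℂ) * E.effect i * (W : Matrix a a ℂ)ᴴ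
  effect_posSemidef i := (E.effect_posSemidef i).mul_mul_conjTranspose_same _
  sum_effect := by
    rw [← Finset.sum_mul, ← Finset.mul_sum, E.sum_effect, Matrix.mul_one]
    exact Unitary.coe_mul_star_self W

theorem POVM.IsProjective.conj {E : POVM a} (hE : E.IsProjective) (W : Matrix.unitaryGroup a ℂ) :
    (E.conj W).IsProjective := fun i => by
  have hW : (W : Matrix a a ℂ)ᴴ * (W : Matrix a a ℂ) = 1 := Unitary.coe_star_mul_self W
  calc (W : Matrix a a ℂ) * E.effect i * (W : Matrix a a ℂ)ᴴ
        * (W * E.effect i * (W : Matrix a a ℂ)ᴴ)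
      = W * E.effect i * ((W : Matrix a a ℂ)ᴴ * W) * E.effect i * (W : Matrix a a ℂ)ᴴ := by
        simp only [Matrix.mul_assoc]
    _ = W * (E.effect i * E.effect i) * (W : Matrix a a ℂ)ᴴ := by
        rw [hW, Matrix.mul_one]; simp only [Matrix.mul_assoc]
    _ = W * E.effect i * (W : Matrix a a ℂ)ᴴ := by rw [hE i]

/-- Stability under rotations is the only property of the three classes that the argument uses. -/
theorem POVM.conj_mem {n : ℕ} {𝓜 : Set (POVM a)}
    (h𝓜 : 𝓜 = nPOVMs a n ∨ 𝓜 = nPVMs a n ∨ 𝓜 = PVMs a)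
    {E : POVM a} (hE : E ∈ 𝓜) (W : Matrix.unitaryGroup a ℂ) : E.conj W ∈ 𝓜 := by
  rcases h𝓜 with rfl | rfl | rfl
  · exact hE
  · exact ⟨hE.1, hE.2.conj W⟩
  · exact POVM.IsProjective.conj hE W

end Symmetry

/-! ### Translates and mixtures of LHS ensembles -/

section Simulation

theorem IsResponse.le_one {b : Type*} [Fintype b] {n : ℕ} {r : Fin n → PureState b → ℝ}
    (hr : IsResponse r) (i : Fin n) (P : PureState b) : r i P ≤ 1 := by
  rw [← hr.sum_eq_one P]
  exact Finset.single_le_sum (f := fun i => r i P) (fun j _ => hr.nonneg j P) (Finset.mem_univ i)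

theorem IsResponse.integrable_entry {b : Type*} [Fintype b] {n : ℕ}
    {r : Fin n → PureState b → ℝ} (hr : IsResponse r) (u : Measure (PureState b))
    [IsFiniteMeasure u] (i : Fin n) (j k : b) :
    Integrable (fun P : PureState b => (r i P : ℂ) * P.1 j k) u := by
  refine Integrable.of_bound ((Complex.measurable_ofReal.comp (hr.measurable i)).mul
    (PureState.continuous_entry j k).measurable).aestronglyMeasurable 1
    (Filter.Eventually.of_forall fun P => ?_)
  rw [norm_mul, Complex.norm_real, Real.norm_of_nonneg (hr.nonneg i P)]
  exact mul_le_one₀ (hr.le_one i P) (norm_nonneg _) (norm_entry_le_one P.2.1 P.2.2.1 j k)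

/-- The real part of a matrix entry, as a continuous function of the pure state. -/
def PureState.entryRe {b : Type*} [Fintype b] (j k : b) : C(PureState b, ℝ) :=
  ⟨fun P => (P.1 j k).re, Complex.continuous_re.comp (PureState.continuous_entry j k)⟩

/-- The imaginary part of a matrix entry, as a continuous function of the pure state. -/
def PureState.entryIm {b : Type*} [Fintype b] (j k : b) : C(PureState b, ℝ) :=
  ⟨fun P => (P.1 j k).im, Complex.continuous_im.comp (PureState.continuous_entry j k)⟩

/-- Together with the imaginary part, this reduces the matrix identity to integrals against real
continuous functions, the form that `exists_response_bind` handles. -/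
theorem IsResponse.simulated_re {b : Type*} [Fintype b] {n : ℕ}
    {r : Fin n → PureState b → ℝ} (hr : IsResponse r) (u : Measure (PureState b))
    [IsFiniteMeasure u] (i : Fin n) (j k : b) :
    (simulated u (r i) j k).re = ∫ P, r i P * PureState.entryRe j k P ∂u := by
  refine (Complex.reCLM.integral_comp_comm (hr.integrable_entry u i j k)).symm.trans
    (integral_congr_ae (Filter.Eventually.of_forall fun P => ?_))
  simp [PureState.entryRe]

theorem IsResponse.simulated_im {b : Type*} [Fintype b] {n : ℕ}
    {r : Fin n → PureState b → ℝ} (hr : IsResponse r) (u : Measure (PureState b))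
    [IsFiniteMeasure u] (i : Fin n) (j k : b) :
    (simulated u (r i) j k).im = ∫ P, r i P * PureState.entryIm j k P ∂u := by
  refine (Complex.imCLM.integral_comp_comm (hr.integrable_entry u i j k)).symm.trans
    (integral_congr_ae (Filter.Eventually.of_forall fun P => ?_))
  simp [PureState.entryIm]

variable {a b G : Type*} [Fintype a] [DecidableEq a] [Fintype b] [DecidableEq b]

open ProbabilityTheory in
/-- A mixture of LHS ensembles is an LHS ensemble. -/
theorem IsLHSEnsemble.bind {ρ : Matrix (a × b) (a × b) ℂ} {𝓜 : Set (POVM a)} {Ω : Type*}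
    [MeasurableSpace Ω] (μ : Measure Ω) [IsProbabilityMeasure μ] (κ : Kernel Ω (PureState b))
    (hκ : ∀ ω, IsLHSEnsemble ρ 𝓜 (κ ω)) : IsLHSEnsemble ρ 𝓜 (μ.bind κ) := by
  have : IsMarkovKernel κ := ⟨fun ω => (hκ ω).isProbabilityMeasure⟩
  refine ⟨inferInstance, fun E hE => ?_⟩
  choose r hr hs using fun ω => (hκ ω).simulates E hE
  obtain ⟨g, hg, hg0, hg1, hgr⟩ := exists_response_bind μ κ r (fun ω => (hr ω).measurable)
    (fun ω => (hr ω).nonneg) (fun ω => (hr ω).sum_eq_one)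
  have hgresp : IsResponse g := ⟨hg, hg0, hg1⟩
  refine ⟨g, hgresp, fun i => ?_⟩
  ext j k
  apply Complex.ext
  · rw [hgresp.simulated_re, hgr i (PureState.entryRe j k) (steer ρ (E.effect i) j k).re]
    intro ω
    rw [← (hr ω).simulated_re, hs]
  · rw [hgresp.simulated_im, hgr i (PureState.entryIm j k) (steer ρ (E.effect i) j k).im]
    intro ω
    rw [← (hr ω).simulated_im, hs]

theorem IsResponse.comp {b : Type*} [Fintype b] {n : ℕ} {r : Fin n → PureState b → ℝ}
    (hr : IsResponse r) {T : PureState b → PureState b} (hT : Measurable T) :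
    IsResponse fun i P => r i (T P) :=
  ⟨fun i => (hr.measurable i).comp hT, fun i _ => hr.nonneg i _, fun _ => hr.sum_eq_one _⟩

theorem IsResponse.simulated_map_conj {n : ℕ} {r : Fin n → PureState b → ℝ} (hr : IsResponse r)
    (u : Measure (PureState b)) [IsFiniteMeasure u] (W : Matrix.unitaryGroup b ℂ) (i : Fin n) :
    simulated (u.map (PureState.conj W)) (fun P => r i (PureState.conj W⁻¹ P)) =
      (W : Matrix b b ℂ) * simulated u (r i) * (W : Matrix b b ℂ)ᴴ := by
  ext j k
  rw [simulated, Matrix.of_apply, integral_map (PureState.measurable_conj W).aemeasurable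
    (((hr.comp (PureState.measurable_conj W⁻¹)).integrable_entry _ i j k).aestronglyMeasurable)]
  simp_rw [PureState.conj_inv_conj]
  simp only [PureState.conj, simulated, Matrix.mul_apply, Matrix.of_apply, Finset.sum_mul,
    Finset.mul_sum]
  have hint : ∀ x x', Integrable (fun P : PureState b =>
      (r i P : ℂ) * ((W : Matrix b b ℂ) j x' * P.1 x' x * (W : Matrix b b ℂ)ᴴ x k)) u := by
    intro x x'
    refine (((hr.integrable_entry u i x' x).const_mul ((W : Matrix b b ℂ) j x')).mul_const
      ((W : Matrix b b ℂ)ᴴ x k)).congr (Filter.Eventually.of_forall fun P => ?_)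
    simp only
    ring
  rw [integral_finsetSum _ fun x _ => integrable_finsetSum _ fun x' _ => hint x x']
  refine Finset.sum_congr rfl fun x _ => ?_
  rw [integral_finsetSum _ fun x' _ => hint x x']
  refine Finset.sum_congr rfl fun x' _ => ?_
  rw [← integral_const_mul, ← integral_mul_const]
  refine integral_congr_ae (Filter.Eventually.of_forall fun P => ?_)
  simp only
  ring

/-- To simulate `E` with the translate, take the responses of `u` to `E` rotated back by `U g` and
evaluate them at the state rotated back by `V g`. -/
theorem IsLHSEnsemble.actEnsemble [Group G] {ρ : Matrix (a × b) (a × b) ℂ}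
    {U : G →* Matrix.unitaryGroup a ℂ} {V : G →* Matrix.unitaryGroup b ℂ}
    (hsymm : IsSymmetric ρ U V) {𝓜 : Set (POVM a)} (h𝓜 : ∀ E ∈ 𝓜, ∀ W, E.conj W ∈ 𝓜)
    {u : Measure (PureState b)} (hu : IsLHSEnsemble ρ 𝓜 u) (g : G) :
    IsLHSEnsemble ρ 𝓜 (actEnsemble V g u) := by
  have := hu.isProbabilityMeasure
  refine ⟨Measure.isProbabilityMeasure_map (PureState.measurable_conj _).aemeasurable,
    fun E hE => ?_⟩
  obtain ⟨r, hr, hs⟩ := hu.simulates _ (h𝓜 E hE (U g)⁻¹)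
  refine ⟨fun i P => r i (PureState.conj (V g)⁻¹ P), hr.comp (PureState.measurable_conj _),
    fun i => ?_⟩
  have hUg : (U g : Matrix a a ℂ) * (U g : Matrix a a ℂ)ᴴ = 1 := Unitary.coe_mul_star_self (U g)
  have hE' : E.effect i = (U g : Matrix a a ℂ) * (E.conj (U g)⁻¹).effect i *
      (U g : Matrix a a ℂ)ᴴ := by
    have : (E.conj (U g)⁻¹).effect i =
        (U g : Matrix a a ℂ)ᴴ * E.effect i * (U g : Matrix a a ℂ) := by
      change (U g : Matrix a a ℂ)ᴴ * E.effect i * (U g : Matrix a a ℂ)ᴴᴴ = _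
      rw [Matrix.conjTranspose_conjTranspose]
    rw [this]
    calc E.effect i = (U g * (U g : Matrix a a ℂ)ᴴ) * E.effect i *
          (U g * (U g : Matrix a a ℂ)ᴴ) := by rw [hUg, Matrix.one_mul, Matrix.mul_one]
      _ = _ := by simp only [Matrix.mul_assoc]
  rw [Steering.actEnsemble, hr.simulated_map_conj u (V g) i, hE', hsymm.steer_conj g, hs i]

end Simulation

/-! ### Haar averages of ensembles and densities; uniqueness -/

section Average

theorem PureState.measurable_conj_comp {b α : Type*} [Fintype b] [DecidableEq b]
    [MeasurableSpace α] {f : α → Matrix.unitaryGroup b ℂ} {h : α → PureState b}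
    (hf : Measurable f) (hh : Measurable h) : Measurable fun x => PureState.conj (f x) (h x) :=
  fun _ hs => hf.prodMk hh (PureState.measurable_conj_uncurry hs)

open ProbabilityTheory

variable {b G : Type*} [Fintype b] [DecidableEq b] [Group G]

theorem actEnsemble_ofDensity_apply [Nonempty b] (V : G →* Matrix.unitaryGroup b ℂ)
    (u : PureState b → ℝ≥0) (hu : Measurable u) (g : G) {s : Set (PureState b)}
    (hs : MeasurableSet s) :
    actEnsemble V g (ofDensity u) s =
      ∫⁻ P in s, (u (PureState.conj (V g)⁻¹ P) : ℝ≥0∞) ∂(uniform b) := by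
  rw [actEnsemble, Measure.map_apply (PureState.measurable_conj _) hs, ofDensity,
    withDensity_apply _ (PureState.measurable_conj _ hs),
    ← (measurePreserving_conj_uniform (V g)).setLIntegral_comp_preimage hs
      (f := fun P => (u (PureState.conj (V g)⁻¹ P) : ℝ≥0∞))
      (hu.comp (PureState.measurable_conj _)).coe_nnreal_ennreal]
  simp [PureState.conj_inv_conj]

variable [TopologicalSpace G] [MeasurableSpace G] [BorelSpace G]

/-- Factoring through the second countable unitary group avoids any countability assumption on `G`.
-/
theorem measurable_conj_orbit {V : G →* Matrix.unitaryGroup b ℂ} (hV : Continuous V) :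
    Measurable fun x : G × PureState b => PureState.conj (V x.1) x.2 :=
  PureState.measurable_conj_comp (hV.measurable.comp measurable_fst) measurable_snd

theorem measurable_conj_inv_orbit {V : G →* Matrix.unitaryGroup b ℂ} (hV : Continuous V) :
    Measurable fun x : G × PureState b => PureState.conj (V x.1)⁻¹ x.2 :=
  PureState.measurable_conj_comp (hV.measurable.comp measurable_fst).inv measurable_snd

/-- The translates `R_V(g) u` of an ensemble, as a kernel. -/
noncomputable def actKernel (V : G →* Matrix.unitaryGroup b ℂ) (hV : Continuous V)
    (u : Measure (PureState b)) [IsFiniteMeasure u] : Kernel G (PureState b) where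
  toFun g := actEnsemble V g u
  measurable' := by
    refine Measure.measurable_of_measurable_coe _ fun s hs => ?_
    simp_rw [actEnsemble, Measure.map_apply (PureState.measurable_conj _) hs]
    exact measurable_measure_prodMk_left (measurable_conj_orbit hV hs)

variable [IsTopologicalGroup G] [CompactSpace G]

/-- The average of the translates of an ensemble. -/
noncomputable def average (V : G →* Matrix.unitaryGroup b ℂ) (hV : Continuous V)
    (u : Measure (PureState b)) [IsFiniteMeasure u] : Measure (PureState b) :=
  (Measure.haarMeasure (⊤ : TopologicalSpace.PositiveCompacts G)).bind (actKernel V hV u)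

theorem average_apply (V : G →* Matrix.unitaryGroup b ℂ) (hV : Continuous V)
    (u : Measure (PureState b)) [IsFiniteMeasure u] {s : Set (PureState b)}
    (hs : MeasurableSet s) :
    average V hV u s =
      ∫⁻ g, actEnsemble V g u s ∂(Measure.haarMeasure (⊤ : TopologicalSpace.PositiveCompacts G)) :=
  Measure.bind_apply hs (actKernel V hV u).measurable.aemeasurable

theorem actEnsemble_average (V : G →* Matrix.unitaryGroup b ℂ) (hV : Continuous V)
    (u : Measure (PureState b)) [IsFiniteMeasure u] (h : G) :
    average V hV u = actEnsemble V h (average V hV u) := by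
  ext s hs
  rw [actEnsemble, Measure.map_apply (PureState.measurable_conj _) hs, average_apply V hV u hs,
    average_apply V hV u (PureState.measurable_conj _ hs),
    -- Substituting `h * g` for `g` on the left matches the extra conjugation by `V h` on the right.
    ← lintegral_mul_left_eq_self _ h]
  refine lintegral_congr fun g => ?_
  rw [actEnsemble, actEnsemble, Measure.map_apply (PureState.measurable_conj _) hs,
    Measure.map_apply (PureState.measurable_conj _) (PureState.measurable_conj _ hs)]
  congr 1
  ext P
  simp [PureState.conj_conj]

/-- An invariant ensemble of a transitive action is the distribution of a random translate of any
given pure state. -/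
theorem apply_eq_haarMeasure_of_invariant {V : G →* Matrix.unitaryGroup b ℂ} (hV : Continuous V)
    (htrans : ActsTransitively V) (u : Measure (PureState b)) [IsProbabilityMeasure u]
    (hu : ∀ g, u = actEnsemble V g u) (P₀ : PureState b) {s : Set (PureState b)}
    (hs : MeasurableSet s) :
    u s = Measure.haarMeasure (⊤ : TopologicalSpace.PositiveCompacts G)
      {g | PureState.conj (V g)⁻¹ P₀ ∈ s} := by
  have := isProbabilityMeasure_haarMeasure_top (G := G)
  let μ := Measure.haarMeasure (⊤ : TopologicalSpace.PositiveCompacts G)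
  have hT := measurable_conj_inv_orbit hV hs
  -- One set is measured in both orders. For fixed `g`, invariance of `u` gives `u s`; for fixed
  -- `P`, transitivity reduces to `P₀`. The inverse turns the change of base point into a left
  -- translation of `g`.
  have h1 : (μ.prod u) ((fun x : G × PureState b => PureState.conj (V x.1)⁻¹ x.2) ⁻¹' s) = u s := by
    rw [Measure.prod_apply hT]
    have : ∀ g, u (Prod.mk g ⁻¹' ((fun x : G × PureState b => PureState.conj (V x.1)⁻¹ x.2) ⁻¹' s))
        = u s := fun g => by
      conv_rhs => rw [hu g⁻¹, actEnsemble, Measure.map_apply (PureState.measurable_conj _) hs,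
        map_inv]
      rfl
    simp_rw [this]
    simp [μ]
  rw [← h1, Measure.prod_apply_symm hT]
  have : ∀ P, μ ((fun g => (g, P)) ⁻¹'
      ((fun x : G × PureState b => PureState.conj (V x.1)⁻¹ x.2) ⁻¹' s)) =
      μ {g | PureState.conj (V g)⁻¹ P₀ ∈ s} := fun P => by
    obtain ⟨h, rfl⟩ := htrans P₀ P
    have hpre : (fun g => (g, PureState.conj (V h) P₀)) ⁻¹'
        ((fun x : G × PureState b => PureState.conj (V x.1)⁻¹ x.2) ⁻¹' s) =
        (h⁻¹ * ·) ⁻¹' {g | PureState.conj (V g)⁻¹ P₀ ∈ s} := by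
      ext g
      simp [PureState.conj_conj]
    rw [hpre, measure_preimage_mul]
  simp_rw [this]
  simp [μ]

/-- The average of a density over the group. -/
noncomputable def averageDensity (V : G →* Matrix.unitaryGroup b ℂ) (u : PureState b → ℝ≥0)
    (P : PureState b) : ℝ≥0∞ :=
  ∫⁻ g, (u (PureState.conj (V g)⁻¹ P) : ℝ≥0∞)
    ∂(Measure.haarMeasure (⊤ : TopologicalSpace.PositiveCompacts G))

theorem measurable_averageDensity {V : G →* Matrix.unitaryGroup b ℂ} (hV : Continuous V)
    {u : PureState b → ℝ≥0} (hu : Measurable u) : Measurable (averageDensity V u) :=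
  have := isProbabilityMeasure_haarMeasure_top (G := G)
  ((hu.comp (measurable_conj_inv_orbit hV)).coe_nnreal_ennreal).lintegral_prod_left'

/-- Left invariance applies at each `P` separately, so the density is invariant everywhere and not
just almost everywhere. -/
theorem averageDensity_conj_inv (V : G →* Matrix.unitaryGroup b ℂ) (u : PureState b → ℝ≥0)
    (h : G) (P : PureState b) :
    averageDensity V u (PureState.conj (V h)⁻¹ P) = averageDensity V u P := by
  unfold averageDensity
  conv_rhs => rw [← lintegral_mul_left_eq_self _ h]
  simp [PureState.conj_conj]

variable [Nonempty b]

theorem average_ofDensity {V : G →* Matrix.unitaryGroup b ℂ} (hV : Continuous V)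
    {u : PureState b → ℝ≥0} (hu : Measurable u) [IsFiniteMeasure (ofDensity u)] :
    average V hV (ofDensity u) = (uniform b).withDensity (averageDensity V u) := by
  have := isProbabilityMeasure_haarMeasure_top (G := G)
  ext s hs
  rw [average_apply _ _ _ hs, withDensity_apply _ hs]
  simp_rw [actEnsemble_ofDensity_apply V u hu _ hs]
  exact lintegral_lintegral_swap
    ((hu.comp (measurable_conj_inv_orbit hV)).coe_nnreal_ennreal).aemeasurable

theorem ofDensity_toNNReal_averageDensity {V : G →* Matrix.unitaryGroup b ℂ} (hV : Continuous V)
    {u : PureState b → ℝ≥0} (hu : Measurable u) [IsFiniteMeasure (ofDensity u)]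
    [IsFiniteMeasure (average V hV (ofDensity u))] :
    ofDensity (fun P => (averageDensity V u P).toNNReal) = average V hV (ofDensity u) := by
  have h := average_ofDensity hV hu
  -- The averaged density may be infinite somewhere, but only on a null set since its total mass is
  -- finite; `toNNReal` therefore leaves the measure unchanged.
  have hfin : ∫⁻ P, averageDensity V u P ∂(uniform b) ≠ ∞ := by
    rw [← setLIntegral_univ, ← withDensity_apply _ MeasurableSet.univ, ← h]
    exact measure_ne_top _ _
  rw [h]
  refine withDensity_congr_ae ?_
  filter_upwards [ae_lt_top (measurable_averageDensity hV hu) hfin] with P hP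
  exact ENNReal.coe_toNNReal hP.ne

end Average

end Steering

/-! ### The symmetric LHS ensembles -/

theorem theorem2 {a b G : Type*} [Fintype a] [DecidableEq a]
    [Fintype b] [DecidableEq b] [Nonempty b]
    [Group G] [TopologicalSpace G] [IsTopologicalGroup G] [CompactSpace G]
    (U : G →* Matrix.unitaryGroup a ℂ) (hU : Continuous U)
    (V : G →* Matrix.unitaryGroup b ℂ) (hV : Continuous V)
    (ρ : Matrix (a × b) (a × b) ℂ) (hρ : Steering.IsState ρ)
    (hsymm : Steering.IsSymmetric ρ U V)
    (n : ℕ) (𝓜 : Set (Steering.POVM a))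
    (h𝓜 : 𝓜 = Steering.nPOVMs a n ∨ 𝓜 = Steering.nPVMs a n ∨ 𝓜 = Steering.PVMs a) :
    -- an unsteerable state admits an invariant LHS ensemble
    (Steering.Unsteerable ρ 𝓜 →
      ∃ u : Measure (Steering.PureState b), Steering.IsLHSEnsemble ρ 𝓜 u ∧
        ∀ g, u = Steering.actEnsemble V g u) ∧
    -- if the given LHS ensemble has a density, the invariant one can be chosen with an
    -- (everywhere) invariant density
    ((∃ u : Steering.PureState b → ℝ≥0, Measurable u ∧
        Steering.IsLHSEnsemble ρ 𝓜 (Steering.ofDensity u)) →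
      ∃ u : Steering.PureState b → ℝ≥0, Measurable u ∧
        Steering.IsLHSEnsemble ρ 𝓜 (Steering.ofDensity u) ∧
        ∀ g, u = Steering.actDensity V g u) ∧
    -- in the transitive case the uniform distribution is an LHS ensemble, and it is the only
    -- invariant ensemble
    (Steering.ActsTransitively V →
      (Steering.Unsteerable ρ 𝓜 → Steering.IsLHSEnsemble ρ 𝓜 (Steering.uniform b)) ∧
      ∀ u : Measure (Steering.PureState b), IsProbabilityMeasure u →
        ((∀ g, u = Steering.actEnsemble V g u) ↔ u = Steering.uniform b)) := by
  open Steering in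
  let _ : MeasurableSpace G := borel G
  have : BorelSpace G := ⟨rfl⟩
  have := isProbabilityMeasure_haarMeasure_top (G := G)
  have havg : ∀ (u : Measure (PureState b)) [IsFiniteMeasure u], IsLHSEnsemble ρ 𝓜 u →
      IsLHSEnsemble ρ 𝓜 (average V hV u) := fun u _ hu =>
    IsLHSEnsemble.bind _ (actKernel V hV u) fun g =>
      hu.actEnsemble hsymm (fun _ hE W => POVM.conj_mem h𝓜 hE W) g
  have hinv : Unsteerable ρ 𝓜 → ∃ u : Measure (PureState b), IsLHSEnsemble ρ 𝓜 u ∧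
      ∀ g, u = actEnsemble V g u := by
    rintro ⟨u, hu⟩
    have := hu.isProbabilityMeasure
    exact ⟨average V hV u, havg u hu, actEnsemble_average V hV u⟩
  have hunif : ∀ g, uniform b = actEnsemble V g (uniform b) := fun g =>
    (measurePreserving_conj_uniform (V g)).map_eq.symm
  have huniq : ActsTransitively V → ∀ u : Measure (PureState b), IsProbabilityMeasure u →
      (∀ g, u = actEnsemble V g u) → u = uniform b := by
    intro ht u _ hu
    ext s hs
    -- Both measures are invariant, so both equal the same Haar expression with the same base point.
    rw [apply_eq_haarMeasure_of_invariant hV ht u hu (PureState.basis (Classical.arbitrary b)) hs,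
      apply_eq_haarMeasure_of_invariant hV ht (uniform b) hunif _ hs]
  refine ⟨hinv, ?_, fun ht => ⟨fun hst => ?_, fun u hu => ⟨huniq ht u hu, ?_⟩⟩⟩
  · rintro ⟨u, hu, hLHS⟩
    have := hLHS.isProbabilityMeasure
    have h := havg _ hLHS
    have := h.isProbabilityMeasure
    refine ⟨fun P => (averageDensity V u P).toNNReal,
      (measurable_averageDensity hV hu).ennreal_toNNReal, ?_, fun g => ?_⟩
    · rwa [ofDensity_toNNReal_averageDensity hV hu]
    · funext P
      simp only [actDensity]
      rw [averageDensity_conj_inv]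
  · obtain ⟨u, hu, hui⟩ := hinv hst
    rwa [huniq ht u hu.isProbabilityMeasure hui] at hu
  · rintro rfl
    exact hunif
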